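/- **Setting.** Let $p\ge 1$, $n\ge 2$, and let $t_1=\dots=t_{p+1}=0$, $t_{p+1+i}=i/n$ $(0\le i\le n)$, $t_{p+n+1}=\dots=t_{2p+n+1}=1$. Let $\mathbb Q\in\{\mathbb H,\mathbb T\}$ (hyperbolic, trigonometric) and let $\mu$ be the phase parameter, with $\mu>0$ for $\mathbb Q=\mathbb H$ and $0<\mu<n\pi$ for $\mathbb Q=\mathbb T$. With $s=\sinh$ for $\mathbb H$ and $s=\sin$ for $\mathbb T$, let $$N_{i,1}(x)=\frac{s(\mu(x-t_i))}{s(\mu(t_{i+1}-t_i))}\ \text{ on }[t_i,t_{i+1}),\qquad N_{i,1}(x)=\frac{s(\mu(t_{i+2}-x))}{s(\mu(t_{i+2}-t_{i+1}))}\ \text{ on }[t_{i+1},t_{i+2}),$$ and $N_{i,1}=0$ elsewhere, and for $q\ge 1$ $$N_{i,q+1}(x)=\frac{\int_0^x N_{i,q}}{\int_0^1N_{i,q}}-\frac{\int_0^x N_{i+1,q}}{\int_0^1N_{i+1,q}},$$ where a quotient with index $j$ such that $t_j=t_{j+q+1}$ is read as $1$ for $x\ge t_j$ and $0$ for $x<t_j$.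 The functions $N_{i,p}^{\mathbb Q_\mu}:=N_{i,p}$ are the generalized B-splines of degree $p$. For $1\le i,j\le n+p-2$ define $$(K)_{ij}=\tfrac1n\int_0^1 N_{j+1,p}'N_{i+1,p}',\qquad (H)_{ij}=\int_0^1 N_{j+1,p}'N_{i+1,p},\qquad (M)_{ij}=n\int_0^1 N_{j+1,p}N_{i+1,p},$$ with $N_{i,p}=N_{i,p}^{\mathbb Q_\mu}$, and for $\beta\in\mathbb R$, $\gamma\ge0$ let $$A_{n,p}^{\mathbb Q_\mu}=nK+\beta H+\frac{\gamma}{n}M .$$ Fix a number $\alpha$ and one of two cases: nested, $\mu=\mu_n=\alpha$ for every $n$; or non-nested, $\mu=\mu_n=n\alpha$. Let $C_p^{\mathbb Q_\nu}\ge 0$ be the largest constant (depending only on $p$, $\mathbb Q$, $\alpha$ and the case) such that $$C_p^{\mathbb Q_\nu}\,\frac{\|\mathbf x\|^2}{n}\le\Big\|\sum_{i=1}^{n+p-2}x_iN_{i+1,p}^{\mathbb Q_{\mu_n}}\Big\|_{L_2([0,1])}^2$$ for all $\mathbf x\in\mathbb R^{n+p-2}$ and all $n\ge2$ for which $\mu_n$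 is allowed (i.e. $\mu_n>0$, and $\mu_n<n\pi$ if $\mathbb Q=\mathbb T$). **Theorem.** Let $p\ge2$, $n\ge2$, $\beta\in\mathbb R$, $\gamma\ge0$, let $\mu=\mu_n$ be allowed, and let $\lambda_{\min}(A_{n,p}^{\mathbb Q_\mu})\in\mathbb C$ be an eigenvalue of $A_{n,p}^{\mathbb Q_\mu}$ of minimum modulus. Then, with $\operatorname{Re}X=(X+X^*)/2$ and $\lambda_{\min}(\operatorname{Re}X)$ its smallest eigenvalue, $C_p^{\mathbb Q_\nu}\ge0$ and $$|\lambda_{\min}(A_{n,p}^{\mathbb Q_\mu})|\ \ge\ \lambda_{\min}(\operatorname{Re}A_{n,p}^{\mathbb Q_\mu})\ \ge\ \frac{C_p^{\mathbb Q_\nu}(\pi^2+\gamma)}{n}.$$ -/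

import Mathlib

/-- The two families of generalized B-splines: hyperbolic (local spaces spanned by
`1, x, …, x ^ (p - 2), cosh (μ x), sinh (μ x)`) and trigonometric (the same with `cos`, `sin`). -/
inductive GBKind
  | hyperbolic
  | trigonometric

/-- In the nested case the phase parameter is a fixed `α`, in the non-nested case it is `n α`. -/
inductive GBRegime
  | nested
  | nonNested

namespace GBSpline

/-- `sinh` or `sin`. -/
noncomputable def sineFn : GBKind → ℝ → ℝ
  | .hyperbolic => Real.sinh
  | .trigonometric => Real.sin

/-- The phase parameter `μ`: `α` in the nested case and `n α` in the non-nested case. -/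
def phase (ν : GBRegime) (n : ℕ) (α : ℝ) : ℝ :=
  match ν with
  | .nested => α
  | .nonNested => n * α

/-- The restriction on the phase parameter `μ` for knot intervals of length `1 / n`: none besides
`μ > 0` in the hyperbolic case, and `0 < μ / n < π` in the trigonometric case. -/
def Admissible (Q : GBKind) (n : ℕ) (μ : ℝ) : Prop :=
  match Q with
  | .hyperbolic => 0 < μ
  | .trigonometric => 0 < μ ∧ μ < n * Real.pi

/-- The open uniform knot sequence `t_1 ≤ … ≤ t_{n + 2p + 1}` on `[0, 1]` (index starting at `1`):
`t_1 = … = t_{p+1} = 0`, `t_{p+1+i} = i / n` for `0 ≤ i ≤ n`, `t_{p+n+1} = … = t_{2p+n+1} = 1`. -/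
noncomputable def knot (n p i : ℕ) : ℝ := ((min (i - (p + 1)) n : ℕ) : ℝ) / n

/-- The unique element of `span {cosh (μ x), sinh (μ x)}` (resp. `span {cos (μ x), sin (μ x)}`)
with value `0` at `a` and `1` at `b`. -/
noncomputable def interp (Q : GBKind) (μ a b x : ℝ) : ℝ :=
  sineFn Q (μ * (x - a)) / sineFn Q (μ * (b - a))

/-- `gbs Q μ n p q i x` is the value at `x` of the `i`-th generalized B-spline of degree `q + 1` with
phase parameter `μ` over the knot sequence `knot n p`. In degree one it is the piecewise
hyperbolic (trigonometric) hat function; then, with `N_{i,q}` denoting degree `q`,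
`N_{i,q+1} (x) = ∫_0^x N_{i,q} / ∫_0^1 N_{i,q} - ∫_0^x N_{i+1,q} / ∫_0^1 N_{i+1,q}`,
where, as usual, a quotient belonging to a degenerate support `t_i = t_{i+q+1}` is read as
the unit step at that point. -/
noncomputable def gbs (Q : GBKind) (μ : ℝ) (n p : ℕ) : ℕ → ℕ → ℝ → ℝ
  | 0, i, x =>
    if knot n p i ≤ x ∧ x < knot n p (i + 1) then
      interp Q μ (knot n p i) (knot n p (i + 1)) x
    else if knot n p (i + 1) ≤ x ∧ x < knot n p (i + 2) then
      interp Q μ (knot n p (i + 2)) (knot n p (i + 1)) x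
    else 0
  | q + 1, i, x =>
    let step : ℕ → ℝ := fun j =>
      if knot n p j < knot n p (j + q + 2) then
        (∫ s in (0 : ℝ)..x, gbs Q μ n p q j s) / (∫ s in (0 : ℝ)..1, gbs Q μ n p q j s)
      else if knot n p j ≤ x then 1 else 0
    step i - step (i + 1)

/-- The GB-spline `N_{i,p}` of degree `p ≥ 1`, `i = 1, …, n + p`, on `[0, 1]` with `n` uniform
knot intervals. -/
noncomputable def N (Q : GBKind) (μ : ℝ) (n p i : ℕ) : ℝ → ℝ := gbs Q μ n p (p - 1) i

/-- The basis functions `N_{2,p}, …, N_{n+p-1,p}` of the spline space with zero boundary values. -/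
noncomputable def basisFn (Q : GBKind) (μ : ℝ) (n p : ℕ) (i : Fin (n + p - 2)) : ℝ → ℝ :=
  N Q μ n p (i.val + 2)

/-- Normalized stiffness matrix. -/
noncomputable def matK (Q : GBKind) (μ : ℝ) (n p : ℕ) :
    Matrix (Fin (n + p - 2)) (Fin (n + p - 2)) ℝ :=
  Matrix.of fun i j =>
    (1 / (n : ℝ)) * ∫ x in (0 : ℝ)..1, deriv (basisFn Q μ n p j) x * deriv (basisFn Q μ n p i) x

/-- Advection matrix. -/
noncomputable def matH (Q : GBKind) (μ : ℝ) (n p : ℕ) :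
    Matrix (Fin (n + p - 2)) (Fin (n + p - 2)) ℝ :=
  Matrix.of fun i j =>
    ∫ x in (0 : ℝ)..1, deriv (basisFn Q μ n p j) x * basisFn Q μ n p i x

/-- Normalized mass matrix. -/
noncomputable def matM (Q : GBKind) (μ : ℝ) (n p : ℕ) :
    Matrix (Fin (n + p - 2)) (Fin (n + p - 2)) ℝ :=
  Matrix.of fun i j =>
    (n : ℝ) * ∫ x in (0 : ℝ)..1, basisFn Q μ n p j x * basisFn Q μ n p i x

/-- The Galerkin matrix `A = n K + β H + (γ / n) M`, as a complex matrix. -/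
noncomputable def matA (Q : GBKind) (μ : ℝ) (n p : ℕ) (β γ : ℝ) :
    Matrix (Fin (n + p - 2)) (Fin (n + p - 2)) ℂ :=
  ((n : ℝ) • matK Q μ n p + β • matH Q μ n p + (γ / n) • matM Q μ n p).map (fun r : ℝ => (r : ℂ))

/-- The smallest eigenvalue of a Hermitian matrix (of positive size). -/
noncomputable def lambdaMin {m : ℕ} (X : selfAdjoint (Matrix (Fin m) (Fin m) ℂ)) : ℝ :=
  ⨅ i, (Matrix.isHermitian_iff_isSelfAdjoint.mpr X.2).eigenvalues i

/-- `C` is a constant, independent of `n` and of `x`, in the lower stability estimate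
`C ‖x‖² / n ≤ ‖∑ i, x_i N_{i+1,p}‖²` (norm of `L²(0,1)` on the right). -/
def IsStabilityConst (Q : GBKind) (ν : GBRegime) (p : ℕ) (α C : ℝ) : Prop :=
  0 ≤ C ∧ ∀ n : ℕ, 2 ≤ n → Admissible Q n (phase ν n α) →
    ∀ x : EuclideanSpace ℝ (Fin (n + p - 2)),
      C * ‖x‖ ^ 2 / n ≤
        ∫ t in (0 : ℝ)..1, (∑ i, x i * basisFn Q (phase ν n α) n p i t) ^ 2

/-- The largest constant in the lower stability estimate. -/
noncomputable def stabilityConst (Q : GBKind) (ν : GBRegime) (p : ℕ) (α : ℝ) : ℝ :=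
  sSup {C : ℝ | IsStabilityConst Q ν p α C}

/-- The supremum is attained, so that `stabilityConst` is itself a constant in the estimate. -/
theorem isGreatest_stabilityConst (Q : GBKind) (ν : GBRegime) (p n : ℕ) (α : ℝ) (hn : 2 ≤ n)
    (hp : 1 ≤ p) (hα : Admissible Q n (phase ν n α)) :
    IsGreatest {C : ℝ | IsStabilityConst Q ν p α C} (stabilityConst Q ν p α) := by
  have hne : ({C : ℝ | IsStabilityConst Q ν p α C}).Nonempty := by
    refine ⟨0, le_refl 0, fun m _ _ x => ?_⟩
    rw [zero_mul, zero_div]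
    exact intervalIntegral.integral_nonneg zero_le_one fun t _ => sq_nonneg _
  have hbdd : BddAbove {C : ℝ | IsStabilityConst Q ν p α C} := by
    let x : EuclideanSpace ℝ (Fin (n + p - 2)) := EuclideanSpace.single ⟨0, by omega⟩ 1
    have hx : ‖x‖ = 1 := by simp [x]
    refine ⟨(∫ t in (0 : ℝ)..1, (∑ i, x i * basisFn Q (phase ν n α) n p i t) ^ 2) * n, ?_⟩
    rintro C ⟨_, hC⟩
    have h := hC n hn hα x
    have hn0 : (0 : ℝ) < n := by exact_mod_cast (by omega : 0 < n)
    rwa [hx, one_pow, mul_one, div_le_iff₀ hn0] at h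
  refine ⟨⟨Real.sSup_nonneg fun C hC => hC.1, fun m hm hadm x => ?_⟩, fun C hC => le_csSup hbdd hC⟩
  have hm0 : (0 : ℝ) < m := by exact_mod_cast (by omega : 0 < m)
  by_cases hx : x = 0
  · subst hx
    rw [norm_zero, zero_pow two_ne_zero, mul_zero, zero_div]
    exact intervalIntegral.integral_nonneg zero_le_one fun t _ => sq_nonneg _
  · have hx2 : 0 < ‖x‖ ^ 2 := by positivity
    rw [div_le_iff₀ hm0, ← le_div_iff₀ hx2]
    refine csSup_le hne fun C hC => ?_
    rw [le_div_iff₀ hx2, ← div_le_iff₀ hm0]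
    exact hC.2 m hm hadm x

end GBSpline

open GBSpline

namespace GBSpline

open Set MeasureTheory intervalIntegral

/-! For a real vector `a` put `u = ∑ a_i N_{i+1,p}`. The quadratic form of the matrix at `a` is `∫
u'² + β ∫ u' u + γ ∫ u²`. Since `u` vanishes at 0 and 1, the advection term is zero and the Poincaré
inequality with constant `π²` bounds the form below by `(π² + γ) ∫ u²`. The stability constant,
which is attained (`isGreatest_stabilityConst`), turns this into a multiple of `‖a‖²`: this is
`galerkin_quadratic_ge`. The real part of the complex form splits into the real form at `Re v` and
at `Im v`, so the same bound holds for the Hermitian part. An eigenvector of the full matrix,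
inserted in that form, compares `|λ|` with the smallest eigenvalue of the Hermitian part.

The analytic work is to show that the recursively defined splines are regular and have the expected
boundary values (`exists_hasZeroBoundary`). The recursion divides by `∫ N_{j,q}`, so these integrals
must be nonzero; in the trigonometric case this is not evident. It follows from a variation
diminishing property proved by induction on the degree (`GoodLevel`, `goodLevel`): a combination has
fewer sign changes than it has possibly nonzero consecutive coefficients. A single spline therefore
keeps one sign, and by linear independence it is not identically zero, so its integral does not
vanish. The induction step is Rolle's theorem; the base case is a 2×2 determinant on each knot
interval. -/

/-! ### Functions that are bounded and continuous off the knots. -/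

/-- The union of the open knot intervals `(l / n, (l + 1) / n)`. -/
def cells (n : ℕ) : Set ℝ := Ioo 0 1 \ ((fun l : ℕ => (l : ℝ) / n) '' Iic n)

theorem countable_grid (n : ℕ) : ((fun l : ℕ => (l : ℝ) / n) '' Iic n).Countable :=
  ((finite_Iic n).image _).countable

theorem isOpen_cells (n : ℕ) : IsOpen (cells n) :=
  isOpen_Ioo.sdiff ((finite_Iic n).image _).isClosed

theorem cells_subset (n : ℕ) : cells n ⊆ Ioo 0 1 := sdiff_subset

theorem ae_mem_cells (n : ℕ) : ∀ᵐ x : ℝ, x ∈ uIoc (0 : ℝ) 1 → x ∈ cells n := by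
  have h1 : ∀ᵐ x : ℝ, x ∉ ((fun l : ℕ => (l : ℝ) / n) '' Iic n) :=
    (countable_grid n).ae_notMem volume
  have h2 : ∀ᵐ x : ℝ, x ≠ 1 := by simpa using (Set.countable_singleton (1 : ℝ)).ae_notMem volume
  filter_upwards [h1, h2] with x hx hx1 hx2
  rw [uIoc_of_le zero_le_one] at hx2
  exact ⟨⟨hx2.1, lt_of_le_of_ne hx2.2 hx1⟩, hx⟩

theorem cells_ae_eq (n : ℕ) : (cells n : Set ℝ) =ᵐ[volume] (Ioc 0 1 : Set ℝ) := by
  filter_upwards [ae_mem_cells n] with x hx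
  rw [uIoc_of_le zero_le_one] at hx
  exact propext ⟨fun h => Ioo_subset_Ioc_self (cells_subset n h), hx⟩

theorem integral_congr_cells {n : ℕ} {f g : ℝ → ℝ} (h : ∀ x ∈ cells n, f x = g x) :
    ∫ x in (0 : ℝ)..1, f x = ∫ x in (0 : ℝ)..1, g x :=
  intervalIntegral.integral_congr_ae <| (ae_mem_cells n).mono fun _ hx hx' => h _ (hx hx')

/-- Functions that are bounded and continuous on the open knot intervals. -/
structure PiecewiseContinuous (n : ℕ) (f : ℝ → ℝ) : Prop where
  bounded : ∃ C, ∀ x ∈ cells n, |f x| ≤ C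
  continuousOn : ContinuousOn f (cells n)

namespace PiecewiseContinuous

variable {n : ℕ} {f g : ℝ → ℝ}

theorem continuousAt (hf : PiecewiseContinuous n f) {x : ℝ} (hx : x ∈ cells n) :
    ContinuousAt f x := hf.continuousOn.continuousAt ((isOpen_cells n).mem_nhds hx)

theorem congr (hf : PiecewiseContinuous n f) (h : ∀ x ∈ cells n, g x = f x) :
    PiecewiseContinuous n g :=
  ⟨hf.bounded.imp fun _ hC x hx => by rw [h x hx]; exact hC x hx, hf.continuousOn.congr h⟩

theorem intervalIntegrable (hf : PiecewiseContinuous n f) :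
    IntervalIntegrable f volume 0 1 := by
  obtain ⟨C, hC⟩ := hf.bounded
  rw [intervalIntegrable_iff_integrableOn_Ioc_of_le zero_le_one,
    ← integrableOn_congr_set_ae (cells_ae_eq n)]
  have hm : MeasurableSet (cells n) := (isOpen_cells n).measurableSet
  refine IntegrableOn.of_bound ?_ (hf.continuousOn.aestronglyMeasurable hm) C ?_
  · rw [measure_congr (cells_ae_eq n)]; simp
  · exact (ae_restrict_iff' hm).2 (Filter.Eventually.of_forall hC)

theorem intervalIntegrable_of_mem (hf : PiecewiseContinuous n f) {a b : ℝ}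
    (ha : a ∈ Icc (0 : ℝ) 1) (hb : b ∈ Icc (0 : ℝ) 1) : IntervalIntegrable f volume a b :=
  hf.intervalIntegrable.mono_set <| by
    rw [uIcc_of_le (zero_le_one' ℝ)]
    exact uIcc_subset_Icc ha hb

theorem add (hf : PiecewiseContinuous n f) (hg : PiecewiseContinuous n g) :
    PiecewiseContinuous n fun x => f x + g x := by
  obtain ⟨C, hC⟩ := hf.bounded
  obtain ⟨D, hD⟩ := hg.bounded
  exact ⟨⟨C + D, fun x hx => (abs_add_le _ _).trans (add_le_add (hC x hx) (hD x hx))⟩,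
    hf.continuousOn.add hg.continuousOn⟩

theorem mul (hf : PiecewiseContinuous n f) (hg : PiecewiseContinuous n g) :
    PiecewiseContinuous n fun x => f x * g x := by
  obtain ⟨C, hC⟩ := hf.bounded
  obtain ⟨D, hD⟩ := hg.bounded
  refine ⟨⟨C * D, fun x hx => ?_⟩, hf.continuousOn.mul hg.continuousOn⟩
  rw [abs_mul]
  exact mul_le_mul (hC x hx) (hD x hx) (abs_nonneg _) ((abs_nonneg _).trans (hC x hx))

theorem of_continuousOn (hf : ContinuousOn f (Icc 0 1)) : PiecewiseContinuous n f := by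
  have hsub : cells n ⊆ Icc 0 1 := (cells_subset n).trans Ioo_subset_Icc_self
  obtain ⟨C, hC⟩ := isCompact_Icc.exists_bound_of_continuousOn hf
  exact ⟨⟨C, fun x hx => hC x (hsub hx)⟩, hf.mono hsub⟩

theorem const (n : ℕ) (c : ℝ) : PiecewiseContinuous n fun _ => c :=
  of_continuousOn continuousOn_const

theorem sum {ι : Type*} (s : Finset ι) {F : ι → ℝ → ℝ}
    (h : ∀ i ∈ s, PiecewiseContinuous n (F i)) :
    PiecewiseContinuous n fun x => ∑ i ∈ s, F i x := by
  classical
  induction s using Finset.induction_on with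
  | empty => simpa using const n 0
  | insert a s ha ih =>
    simp only [Finset.sum_insert ha]
    exact (h a (by simp)).add (ih fun i hi => h i (by simp [hi]))

theorem continuousOn_primitive (hf : PiecewiseContinuous n f) :
    ContinuousOn (fun x => ∫ s in (0 : ℝ)..x, f s) (Icc 0 1) := by
  have h := intervalIntegral.continuousOn_primitive_interval (μ := volume) (f := f)
    (a := 0) (b := 1) ?_
  · rwa [uIcc_of_le zero_le_one] at h
  · rw [uIcc_of_le zero_le_one, integrableOn_Icc_iff_integrableOn_Ioc]
    exact (intervalIntegrable_iff_integrableOn_Ioc_of_le zero_le_one).1 hf.intervalIntegrable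

theorem hasDerivAt_primitive (hf : PiecewiseContinuous n f) {x : ℝ} (hx : x ∈ cells n) :
    HasDerivAt (fun x => ∫ s in (0 : ℝ)..x, f s) (f x) x := by
  have hx' := Ioo_subset_Icc_self (cells_subset n hx)
  exact intervalIntegral.integral_hasDerivAt_right
    (hf.intervalIntegrable_of_mem (by simp) hx')
    (hf.continuousOn.stronglyMeasurableAtFilter (isOpen_cells n) x hx) (hf.continuousAt hx)

theorem integral_sub_integral (hf : PiecewiseContinuous n f) {a b : ℝ}
    (ha : a ∈ Icc (0 : ℝ) 1) (hb : b ∈ Icc (0 : ℝ) 1) :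
    (∫ s in (0 : ℝ)..b, f s) - ∫ s in (0 : ℝ)..a, f s = ∫ s in a..b, f s :=
  intervalIntegral.integral_interval_sub_left (hf.intervalIntegrable_of_mem (by simp) hb)
    (hf.intervalIntegrable_of_mem (by simp) ha)

end PiecewiseContinuous

/-! ### Sign changes and an integral form of Rolle's theorem. -/

/-- `f` has `k` strict sign changes in `(0, 1)`. -/
def Alternates (f : ℝ → ℝ) (k : ℕ) : Prop :=
  ∃ (x : ℕ → ℝ) (ε : ℝ), (∀ i ≤ k, x i ∈ Ioo (0 : ℝ) 1) ∧ (∀ i < k, x i < x (i + 1)) ∧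
    ∀ i ≤ k, 0 < ε * (-1) ^ i * f (x i)

/-- `f` is alternately falling and rising between `k + 1` points of `[0, 1]`. -/
def Zigzags (f : ℝ → ℝ) (k : ℕ) : Prop :=
  ∃ (y : ℕ → ℝ) (ε : ℝ), (∀ i ≤ k, y i ∈ Icc (0 : ℝ) 1) ∧ (∀ i < k, y i < y (i + 1)) ∧
    ∀ i < k, 0 < ε * (-1) ^ i * (f (y i) - f (y (i + 1)))

theorem Alternates.congr {f g : ℝ → ℝ} {k : ℕ} (h : Alternates f k)
    (hfg : ∀ x ∈ Ioo (0 : ℝ) 1, f x = g x) : Alternates g k := by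
  obtain ⟨x, ε, hx, hlt, hs⟩ := h
  exact ⟨x, ε, hx, hlt, fun i hi => by rw [← hfg _ (hx i hi)]; exact hs i hi⟩

theorem Alternates.zigzags {f : ℝ → ℝ} {k : ℕ} (h : Alternates f k) : Zigzags f k := by
  obtain ⟨x, ε, hx, hlt, hs⟩ := h
  refine ⟨x, ε, fun i hi => Ioo_subset_Icc_self (hx i hi), hlt, fun i hi => ?_⟩
  have h1 := hs i hi.le
  have h2 := hs (i + 1) hi
  rw [pow_succ] at h2
  linarith

/-- A zero at the endpoint gains one monotone swing: from 0 the function must move to its first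
nonzero sample. Prepending a point shifts the indices, hence the sign `-ε`. -/
theorem Alternates.zigzags_left {f : ℝ → ℝ} {k : ℕ} (h : Alternates f k) (h0 : f 0 = 0) :
    Zigzags f (k + 1) := by
  have hz := h.zigzags
  obtain ⟨x, ε, hx, hlt, hs⟩ := h
  refine ⟨fun i => Nat.casesOn i 0 x, -ε, ?_, ?_, ?_⟩
  · rintro (_ | i) hi
    · simp
    · exact Ioo_subset_Icc_self (hx i (by omega))
  · rintro (_ | i) hi
    · exact (hx 0 (by omega)).1
    · exact hlt i (by omega)
  · rintro (_ | i) hi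
    · have := hs 0 (by omega)
      change 0 < -ε * (-1) ^ 0 * (f 0 - f (x 0))
      rw [h0]
      linarith
    · have h1 := hs i (by omega)
      have h2 := hs (i + 1) (by omega)
      simp only [pow_succ] at h2 ⊢
      linarith

theorem Alternates.zigzags_right {f : ℝ → ℝ} {k : ℕ} (h : Alternates f k) (h1 : f 1 = 0) :
    Zigzags f (k + 1) := by
  obtain ⟨x, ε, hx, hlt, hs⟩ := h
  refine ⟨fun i => if i ≤ k then x i else 1, ε, fun i _ => ?_, fun i hi => ?_, fun i hi => ?_⟩
  · dsimp only
    split_ifs with h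
    · exact Ioo_subset_Icc_self (hx i h)
    · simp
  · simp only [show i ≤ k by omega, if_true]
    split_ifs with h
    · exact hlt i (by omega)
    · exact (hx i (by omega)).2
  · simp only [show i ≤ k by omega, if_true]
    have h2 := hs i (by omega)
    split_ifs with h
    · have h3 := hs (i + 1) h
      rw [pow_succ] at h3
      linarith
    · rw [h1]
      linarith

theorem Alternates.zigzags_both {f : ℝ → ℝ} {k : ℕ} (h : Alternates f k) (h0 : f 0 = 0)
    (h1 : f 1 = 0) : Zigzags f (k + 2) := by
  obtain ⟨x, ε, hx, hlt, hs⟩ := h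
  refine ⟨fun i => Nat.casesOn i 0 fun i => if i ≤ k then x i else 1, -ε, ?_, ?_, ?_⟩
  · rintro (_ | i) hi
    · simp
    · dsimp only
      split_ifs with h
      · exact Ioo_subset_Icc_self (hx i h)
      · simp
  · rintro (_ | i) hi
    · simpa using (hx 0 (by omega)).1
    · simp only [show i ≤ k by omega, if_true]
      split_ifs with h
      · exact hlt i (by omega)
      · exact (hx i (by omega)).2
  · rintro (_ | i) hi
    · have := hs 0 (by omega)
      change 0 < -ε * (-1) ^ 0 * (f 0 - f (if 0 ≤ k then x 0 else 1))
      rw [h0, if_pos k.zero_le]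
      linarith
    · simp only [show i ≤ k by omega, if_true]
      have h2 := hs i (by omega)
      rw [pow_succ]
      split_ifs with h
      · have h3 := hs (i + 1) h
        rw [pow_succ] at h3
        linarith
      · rw [h1]
        linarith

theorem exists_pos_of_integral_pos {n : ℕ} {f : ℝ → ℝ} (hf : PiecewiseContinuous n f) {a b : ℝ}
    (ha : a ∈ Icc (0 : ℝ) 1) (hb : b ∈ Icc (0 : ℝ) 1) (hab : a < b) (σ : ℝ)
    (h : 0 < σ * ∫ s in a..b, f s) : ∃ s ∈ Ioo a b, 0 < σ * f s := by
  by_contra! hcon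
  have := intervalIntegral.integral_mono_on_of_le_Ioo (μ := volume) hab.le
    ((hf.intervalIntegrable_of_mem ha hb).const_mul σ) (intervalIntegrable_const (c := 0)) hcon
  rw [intervalIntegral.integral_const_mul] at this
  simp only [intervalIntegral.integral_zero] at this
  linarith

/-- Each rise or fall of `f` is an integral of `f'`, so `f'` takes that sign somewhere strictly in
between. Only the integral relation is used, since `f` may have corners at the knots. -/
theorem Zigzags.alternates {n : ℕ} {f f' : ℝ → ℝ} {k : ℕ} (hf' : PiecewiseContinuous n f')
    (hf : ∀ a ∈ Icc (0 : ℝ) 1, ∀ b ∈ Icc (0 : ℝ) 1, f b - f a = ∫ s in a..b, f' s)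
    (h : Zigzags f (k + 1)) : Alternates f' k := by
  obtain ⟨y, ε, hy, hlt, hs⟩ := h
  have key : ∀ i, ∃ s, i ≤ k → s ∈ Ioo (y i) (y (i + 1)) ∧ 0 < -ε * (-1) ^ i * f' s := by
    intro i
    by_cases hi : i ≤ k
    · obtain ⟨s, hs1, hs2⟩ := exists_pos_of_integral_pos hf' (hy i (by omega))
        (hy (i + 1) (by omega)) (hlt i (by omega)) (-ε * (-1) ^ i) (by
          rw [← hf _ (hy i (by omega)) _ (hy (i + 1) (by omega))]
          linarith [hs i (by omega)])
      exact ⟨s, fun _ => ⟨hs1, hs2⟩⟩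
    · exact ⟨0, fun h => absurd h hi⟩
  choose s hs' using key
  refine ⟨s, -ε, fun i hi => ?_, fun i hi => ?_, fun i hi => (hs' i hi).2⟩
  · exact ⟨(hy i (by omega)).1.trans_lt (hs' i hi).1.1,
      (hs' i hi).1.2.trans_le (hy (i + 1) (by omega)).2⟩
  · exact (hs' i hi.le).1.2.trans (hs' (i + 1) hi).1.1

/-- Without a sign change, `f x₀ * f` is nonnegative on `(0, 1)`, and by continuity it is positive
near `x₀`. -/
theorem integral_ne_zero_of_not_alternates {n : ℕ} {f : ℝ → ℝ} (hf : PiecewiseContinuous n f)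
    (h : ¬ Alternates f 1) {x₀ : ℝ} (hx₀ : x₀ ∈ cells n) (hfx : f x₀ ≠ 0) :
    ∫ s in (0 : ℝ)..1, f s ≠ 0 := by
  have hU := cells_subset n hx₀
  have hnn : ∀ x ∈ Ioo (0 : ℝ) 1, 0 ≤ f x₀ * f x := by
    intro x hx
    by_contra! hneg
    have hsq : 0 < f x₀ * f x₀ := mul_self_pos.2 hfx
    rcases lt_trichotomy x x₀ with hlt | rfl | hlt
    · refine h ⟨fun i => if i = 0 then x else x₀, -f x₀, fun i _ => ?_, fun i hi => ?_,
        fun i hi => ?_⟩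
      · dsimp only; split_ifs <;> assumption
      · simpa [Nat.lt_one_iff.1 hi] using hlt
      · interval_cases i
        · simp only [if_true, pow_zero]
          linarith
        · simp only [one_ne_zero, if_false, pow_one]
          linarith
    · linarith
    · refine h ⟨fun i => if i = 0 then x₀ else x, f x₀, fun i _ => ?_, fun i hi => ?_,
        fun i hi => ?_⟩
      · dsimp only; split_ifs <;> assumption
      · simpa [Nat.lt_one_iff.1 hi] using hlt
      · interval_cases i
        · simp only [if_true, pow_zero]
          linarith
        · simp only [one_ne_zero, if_false, pow_one]
          linarith
  have hpos : 0 < ∫ s in (0 : ℝ)..1, f x₀ * f s := by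
    rw [intervalIntegral.integral_pos_iff_support_of_nonneg_ae' _
      (hf.intervalIntegrable.const_mul _)]
    · refine ⟨zero_lt_one, Measure.measure_pos_of_mem_nhds volume (x := x₀) ?_⟩
      have hc : ContinuousAt (fun x => f x₀ * f x) x₀ := continuousAt_const.mul (hf.continuousAt hx₀)
      filter_upwards [hc.eventually_ne (mul_ne_zero hfx hfx), isOpen_Ioo.mem_nhds hU] with x h1 h2
      exact ⟨h1, Ioo_subset_Ioc_self h2⟩
    · rw [uIoc_of_le zero_le_one, ← restrict_Ioo_eq_restrict_Ioc]
      exact (ae_restrict_iff' measurableSet_Ioo).2 (Filter.Eventually.of_forall hnn)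
  rw [intervalIntegral.integral_const_mul] at hpos
  exact fun h0 => by simp [h0] at hpos

/-! ### The two sine functions and the hat functions on a knot interval. -/

theorem sineFn_neg (Q : GBKind) (x : ℝ) : sineFn Q (-x) = -sineFn Q x := by
  cases Q
  · exact Real.sinh_neg x
  · exact Real.sin_neg x

theorem sineFn_zero (Q : GBKind) : sineFn Q 0 = 0 := by
  cases Q
  · exact Real.sinh_zero
  · exact Real.sin_zero

theorem continuous_sineFn (Q : GBKind) : Continuous (sineFn Q) := by
  cases Q
  · exact Real.continuous_sinh
  · exact Real.continuous_sin

/-- The one addition formula shared by `sinh` and `sin`; it lets both kinds be treated together from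
here on. -/
theorem sineFn_mul_sub (Q : GBKind) (a b c : ℝ) :
    sineFn Q (c - a) * sineFn Q b - sineFn Q (c - b) * sineFn Q a =
      sineFn Q c * sineFn Q (b - a) := by
  cases Q
  · change Real.sinh _ * Real.sinh _ - Real.sinh _ * Real.sinh _ = Real.sinh _ * Real.sinh _
    simp only [Real.sinh_sub]
    ring
  · change Real.sin _ * Real.sin _ - Real.sin _ * Real.sin _ = Real.sin _ * Real.sin _
    simp only [Real.sin_sub]
    ring

theorem Admissible.pos {Q : GBKind} {n : ℕ} {μ : ℝ} (h : Admissible Q n μ) : 0 < μ := by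
  cases Q
  · exact h
  · exact h.1

theorem Admissible.sineFn_pos {Q : GBKind} {n : ℕ} {μ : ℝ} (h : Admissible Q n μ) {x : ℝ}
    (h0 : 0 < x) (h1 : x * n ≤ 1) : 0 < sineFn Q (μ * x) := by
  have hμ := h.pos
  cases Q
  · exact Real.sinh_pos_iff.2 (mul_pos hμ h0)
  · refine Real.sin_pos_of_pos_of_lt_pi (mul_pos hμ h0) ?_
    calc μ * x < n * Real.pi * x := mul_lt_mul_of_pos_right h.2 h0
      _ = x * n * Real.pi := by ring
      _ ≤ 1 * Real.pi := mul_le_mul_of_nonneg_right h1 Real.pi_pos.le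
      _ = Real.pi := one_mul _

theorem knot_le_iff {n p l : ℕ} (hn : 0 < n) (hl : l < n) {x : ℝ}
    (hx : x ∈ Ico ((l : ℝ) / n) ((l + 1) / n)) (i : ℕ) : knot n p i ≤ x ↔ i ≤ p + 1 + l := by
  have hn' : (0 : ℝ) < n := by exact_mod_cast hn
  unfold knot
  constructor
  · intro h
    have h1 := h.trans_lt hx.2
    rw [div_lt_div_iff_of_pos_right hn'] at h1
    have h2 : min (i - (p + 1)) n < l + 1 := by exact_mod_cast h1
    omega
  · intro h
    refine le_trans ?_ hx.1
    rw [div_le_div_iff_of_pos_right hn']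
    have h2 : min (i - (p + 1)) n ≤ l := by omega
    exact_mod_cast h2

theorem knot_eq {n p l i : ℕ} (hl : l ≤ n) (h : i = p + 1 + l) : knot n p i = (l : ℝ) / n := by
  unfold knot
  rw [show min (i - (p + 1)) n = l by omega]

theorem knot_lt_knot_iff {n p i j : ℕ} (hn : 0 < n) :
    knot n p i < knot n p j ↔ min (i - (p + 1)) n < min (j - (p + 1)) n := by
  have hn' : (0 : ℝ) < n := by exact_mod_cast hn
  unfold knot
  rw [div_lt_div_iff_of_pos_right hn', Nat.cast_lt]

/-- The hat functions on one knot interval. -/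
theorem gbs_zero_of_mem {Q : GBKind} {μ : ℝ} {n p l : ℕ} (hn : 0 < n) (hl : l < n) {x : ℝ}
    (hx : x ∈ Ico ((l : ℝ) / n) ((l + 1) / n)) (j : ℕ) :
    gbs Q μ n p 0 j x = if j = p + (l + 1) then sineFn Q (μ * (x - l / n)) / sineFn Q (μ * (1 / n))
      else if j = p + l then sineFn Q (μ * ((l + 1) / n - x)) / sineFn Q (μ * (1 / n)) else 0 := by
  have hl' : ((l + 1 : ℕ) : ℝ) = l + 1 := by push_cast; rfl
  have hd : ((l : ℝ) + 1) / n - l / n = 1 / n := by ring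
  simp only [gbs, ← not_le, knot_le_iff hn hl hx]
  split_ifs with h1 h2 h2 h3 h3 h3
  · rw [interp, knot_eq hl.le (i := j) (by omega), knot_eq (l := l + 1) hl (i := j + 1) (by omega),
      hl', hd]
  · omega
  · omega
  · omega
  · rw [interp, knot_eq hl.le (i := j + 1) (by omega),
      knot_eq (l := l + 1) hl (i := j + 2) (by omega), hl', ← neg_sub _ x,
      ← neg_sub (((l : ℝ) + 1) / n) ((l : ℝ) / n), mul_neg, mul_neg, sineFn_neg, sineFn_neg, hd,
      neg_div_neg_eq]
  · omega
  · omega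
  · omega
  · rfl

theorem exists_mem_Ico {n : ℕ} (hn : 0 < n) {x : ℝ} (hx : x ∈ Ioo (0 : ℝ) 1) :
    ∃ l < n, x ∈ Ico ((l : ℝ) / n) ((l + 1) / n) := by
  have hn' : (0 : ℝ) < n := by exact_mod_cast hn
  have h0 : 0 ≤ x * n := mul_nonneg hx.1.le hn'.le
  refine ⟨⌊x * n⌋₊, ?_, ?_, ?_⟩
  · rw [Nat.floor_lt h0]
    nlinarith [hx.2]
  · rw [div_le_iff₀ hn']
    exact Nat.floor_le h0
  · rw [lt_div_iff₀ hn']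
    exact Nat.lt_floor_add_one _

theorem Ioo_subset_cells {n l : ℕ} (hl : l < n) :
    Ioo ((l : ℝ) / n) ((l + 1) / n) ⊆ cells n := by
  have hn' : (0 : ℝ) < n := by exact_mod_cast (by omega : 0 < n)
  have hl' : (l : ℝ) + 1 ≤ n := by exact_mod_cast hl
  rintro x ⟨h1, h2⟩
  refine ⟨⟨lt_of_le_of_lt (by positivity) h1, h2.trans_le ((div_le_one hn').2 hl')⟩, ?_⟩
  rintro ⟨m, -, rfl⟩
  simp only at h1 h2
  rw [div_lt_div_iff_of_pos_right hn'] at h1 h2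
  have h3 : l < m := by exact_mod_cast h1
  have h4 : m < l + 1 := by exact_mod_cast h2
  omega

theorem exists_mem_Ioo_of_mem_cells {n : ℕ} (hn : 0 < n) {x : ℝ} (hx : x ∈ cells n) :
    ∃ l < n, x ∈ Ioo ((l : ℝ) / n) ((l + 1) / n) := by
  obtain ⟨l, hl, h1, h2⟩ := exists_mem_Ico hn (cells_subset n hx)
  exact ⟨l, hl, lt_of_le_of_ne h1 fun h => hx.2 ⟨l, hl.le, h⟩, h2⟩

theorem piecewiseContinuous_gbs_zero (Q : GBKind) (μ : ℝ) {n : ℕ} (hn : 0 < n) (p j : ℕ) :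
    PiecewiseContinuous n (gbs Q μ n p 0 j) := by
  have hc : ∀ a b : ℝ, Continuous (interp Q μ a b) := fun a b =>
    ((continuous_sineFn Q).comp (by fun_prop)).div_const _
  constructor
  · obtain ⟨C, hC⟩ := (isCompact_Icc (a := (0 : ℝ)) (b := 1)).exists_bound_of_continuousOn
      (hc (knot n p j) (knot n p (j + 1))).continuousOn
    obtain ⟨D, hD⟩ := (isCompact_Icc (a := (0 : ℝ)) (b := 1)).exists_bound_of_continuousOn
      (hc (knot n p (j + 2)) (knot n p (j + 1))).continuousOn
    refine ⟨max 0 (max C D), fun x hx => ?_⟩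
    have hx' := Ioo_subset_Icc_self (cells_subset n hx)
    simp only [gbs]
    split_ifs
    · exact (hC x hx').trans ((le_max_left _ _).trans (le_max_right _ _))
    · exact (hD x hx').trans ((le_max_right _ _).trans (le_max_right _ _))
    · simp
  · intro x hx
    obtain ⟨l, hl, hxl⟩ := exists_mem_Ioo_of_mem_cells hn hx
    refine ContinuousAt.continuousWithinAt ?_
    have hev : gbs Q μ n p 0 j =ᶠ[nhds x] fun x => if j = p + (l + 1) then
        sineFn Q (μ * (x - l / n)) / sineFn Q (μ * (1 / n)) else if j = p + l then
        sineFn Q (μ * ((l + 1) / n - x)) / sineFn Q (μ * (1 / n)) else 0 := by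
      filter_upwards [isOpen_Ioo.mem_nhds hxl] with y hy
      exact gbs_zero_of_mem hn hl (Ioo_subset_Ico_self hy) j
    refine ContinuousAt.congr (Continuous.continuousAt ?_) hev.symm
    split_ifs
    · exact ((continuous_sineFn Q).comp (by fun_prop)).div_const _
    · exact ((continuous_sineFn Q).comp (by fun_prop)).div_const _
    · exact continuous_const

/-! ### Independence and variation diminution, by induction on the degree. -/

/-- A combination of the nondegenerate B-splines of degree `q + 1`, for `p = q + r`. -/
noncomputable def comb (Q : GBKind) (μ : ℝ) (n p q r : ℕ) (c : ℕ → ℝ) (x : ℝ) : ℝ :=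
  ∑ k ∈ Finset.range (n + q + 1), c k * gbs Q μ n p q (r + k) x

theorem comb_zero_of_mem {Q : GBKind} {μ : ℝ} {n p l : ℕ} (hn : 0 < n) (hl : l < n) {x : ℝ}
    (hx : x ∈ Ico ((l : ℝ) / n) ((l + 1) / n)) (c : ℕ → ℝ) :
    comb Q μ n p 0 p c x = (sineFn Q (μ * ((l + 1) / n - x)) * c l +
      sineFn Q (μ * (x - l / n)) * c (l + 1)) / sineFn Q (μ * (1 / n)) := by
  have : comb Q μ n p 0 p c x = c l * (sineFn Q (μ * ((l + 1) / n - x)) / sineFn Q (μ * (1 / n))) +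
      c (l + 1) * (sineFn Q (μ * (x - l / n)) / sineFn Q (μ * (1 / n))) := by
    unfold comb
    rw [← Finset.sum_subset (s₁ := {l, l + 1}), Finset.sum_pair (by omega)]
    · rw [gbs_zero_of_mem hn hl hx, gbs_zero_of_mem hn hl hx]
      simp
    · intro k hk
      simp only [Finset.mem_insert, Finset.mem_singleton, Finset.mem_range] at hk ⊢
      omega
    · intro k _ hk
      simp only [Finset.mem_insert, Finset.mem_singleton, not_or] at hk
      rw [gbs_zero_of_mem hn hl hx, if_neg (by omega), if_neg (by omega), mul_zero]
  rw [this]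
  ring

/-- What the recursion passes from degree to degree. -/
structure GoodLevel (Q : GBKind) (μ : ℝ) (n p q r : ℕ) : Prop where
  regular : ∀ k < n + q + 1, PiecewiseContinuous n (gbs Q μ n p q (r + k))
  indep : ∀ c : ℕ → ℝ, (∀ x ∈ cells n, comb Q μ n p q r c x = 0) → ∀ k < n + q + 1, c k = 0
  -- Coefficients live in the half-open range `[a, b)`, so `b - a` of them allow at most `b - a - 1`
  -- sign changes.
  variation : ∀ (c : ℕ → ℝ) (a b : ℕ), a ≤ b → (∀ k < n + q + 1, k < a → c k = 0) →
    (∀ k < n + q + 1, b ≤ k → c k = 0) → ¬ Alternates (comb Q μ n p q r c) (b - a)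

section Levels

variable {Q : GBKind} {μ : ℝ} {n p : ℕ}

/-- Eliminating `c` gives `(A B' - A' B) c' = A (A' c + B' c') - A' (A c + B c') < 0`. -/
theorem neg_of_sign_change {A A' B B' c c' : ℝ} (hA : 0 < A) (hA' : 0 < A')
    (h : 0 ≤ A * B' - A' * B) (h1 : 0 < A * c + B * c') (h2 : A' * c + B' * c' < 0) : c' < 0 := by
  by_contra! hc
  have h3 := mul_pos hA' h1
  have h4 := mul_neg_of_pos_of_neg hA h2
  have h5 := mul_nonneg h hc
  linarith

/-- The determinant of the two hat pieces of one knot interval at `x` and `y`. For `x < y` in that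
interval it is positive, so the pieces form a Chebyshev system. -/
theorem sineFn_cell_mul_sub (Q : GBKind) (μ : ℝ) (n l : ℕ) (x y : ℝ) :
    sineFn Q (μ * ((l + 1) / n - x)) * sineFn Q (μ * (y - l / n)) -
      sineFn Q (μ * ((l + 1) / n - y)) * sineFn Q (μ * (x - l / n)) =
      sineFn Q (μ * (1 / n)) * sineFn Q (μ * (y - x)) := by
  rw [show μ * (y - x) = μ * (y - l / n) - μ * (x - l / n) by ring, ← sineFn_mul_sub]
  congr 3 <;> ring_nf

theorem Admissible.sineFn_cell_pos (h : Admissible Q n μ) (hn : 0 < n) {a b l : ℝ}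
    (ha : l / n ≤ a) (hb : b ≤ (l + 1) / n) (hab : a < b) : 0 < sineFn Q (μ * (b - a)) := by
  have hn' : (0 : ℝ) < n := by exact_mod_cast hn
  refine h.sineFn_pos (sub_pos.2 hab) ?_
  rw [div_le_iff₀ hn'] at ha
  rw [le_div_iff₀ hn'] at hb
  linarith

theorem Admissible.sineFn_step_pos (h : Admissible Q n μ) (hn : 0 < n) :
    0 < sineFn Q (μ * (1 / n)) := by
  have hn' : (0 : ℝ) < n := by exact_mod_cast hn
  exact h.sineFn_pos (by positivity) (by field_simp; rfl)

/-- Each further sign change must use a new coefficient. With `l i` the interval of the `i`-th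
sample point, the samples are followed from left to right until the coefficients run out at `b`. -/
theorem not_alternates_comb_zero (h : Admissible Q n μ) (hn : 0 < n) (c : ℕ → ℝ) (a b : ℕ)
    (hca : ∀ k < n + 1, k < a → c k = 0) (hcb : ∀ k < n + 1, b ≤ k → c k = 0) :
    ¬ (a ≤ b ∧ Alternates (comb Q μ n p 0 p c) (b - a)) := by
  rintro ⟨hab, x, ε, hx, hlt, hs⟩
  have hn' : (0 : ℝ) < n := by exact_mod_cast hn
  have hS := h.sineFn_step_pos hn
  have key : ∀ i, ∃ l : ℕ, i ≤ b - a → l < n ∧ x i ∈ Ico ((l : ℝ) / n) ((l + 1) / n) ∧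
      0 < sineFn Q (μ * ((l + 1) / n - x i)) * (ε * (-1) ^ i * c l) +
        sineFn Q (μ * (x i - l / n)) * (ε * (-1) ^ i * c (l + 1)) := by
    intro i
    by_cases hi : i ≤ b - a
    · obtain ⟨l, hl, hxl⟩ := exists_mem_Ico hn (hx i hi)
      refine ⟨l, fun _ => ⟨hl, hxl, ?_⟩⟩
      have := hs i hi
      rw [comb_zero_of_mem hn hl hxl, mul_div_assoc', div_pos_iff_of_pos_right hS] at this
      linarith
    · exact ⟨0, fun h => absurd h hi⟩
  choose l hl using key
  have hA : ∀ i ≤ b - a, 0 < sineFn Q (μ * ((l i + 1) / n - x i)) := fun i hi =>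
    h.sineFn_cell_pos hn (hl i hi).2.1.1 le_rfl (hl i hi).2.1.2
  have hB : ∀ i ≤ b - a, 0 ≤ sineFn Q (μ * (x i - l i / n)) := fun i hi => by
    rcases (hl i hi).2.1.1.eq_or_lt with h0 | h0
    · rw [h0, sub_self, mul_zero, sineFn_zero]
    · exact (h.sineFn_cell_pos hn le_rfl (hl i hi).2.1.2.le h0).le
  have hmono : ∀ i < b - a, l i ≤ l (i + 1) := fun i hi => by
    have h1 := (hl i hi.le).2.1.1.trans_lt ((hlt i hi).trans (hl (i + 1) hi).2.1.2)
    rw [div_lt_div_iff_of_pos_right hn'] at h1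
    have h2 : l i < l (i + 1) + 1 := by exact_mod_cast h1
    omega
  -- Invariant: the `i`-th sample has reached at least coefficient `a + i`; if it has reached no
  -- further, that coefficient carries the sign of the sample.
  have main : ∀ i ≤ b - a, i + a ≤ l i + 1 ∧
      (i + a = l i + 1 → 0 < ε * (-1) ^ i * c (l i + 1)) := by
    intro i
    induction i with
    | zero =>
      intro hi
      obtain ⟨hln, hxl, hpos⟩ := hl 0 hi
      refine ⟨?_, fun h0 => ?_⟩
      · by_contra hcon
        rw [hca (l 0) (by omega) (by omega), hca (l 0 + 1) (by omega) (by omega)] at hpos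
        simp at hpos
      · rw [hca (l 0) (by omega) (by omega), mul_zero, mul_zero, zero_add] at hpos
        exact pos_of_mul_pos_right hpos (hB 0 hi)
    | succ i ih =>
      intro hi
      obtain ⟨ih1, ih2⟩ := ih (by omega)
      obtain ⟨hln, hxl, hpos⟩ := hl i (by omega)
      obtain ⟨hln', hxl', hpos'⟩ := hl (i + 1) hi
      rcases (hmono i (by omega)).eq_or_lt with heq | hlt'
      -- Two consecutive samples in one interval: the determinant forces the right coefficient to
      -- take the sign of the later sample, which excludes equality in the invariant at `i`.
      · have hneg : ε * (-1) ^ i * c (l i + 1) < 0 := by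
          have hA' := hA (i + 1) hi
          rw [← heq] at hA' hpos'
          refine neg_of_sign_change (hA i (by omega)) hA' ?_ hpos ?_ (c := ε * (-1) ^ i * c (l i))
            (B := sineFn Q (μ * (x i - l i / n))) (B' := sineFn Q (μ * (x (i + 1) - l i / n)))
          · rw [sineFn_cell_mul_sub]
            rw [← heq] at hxl'
            exact (mul_pos hS (h.sineFn_cell_pos hn hxl.1 hxl'.2.le (hlt i (by omega)))).le
          · rw [pow_succ] at hpos'
            linarith
        rw [← heq]
        have hne : i + a ≠ l i + 1 := fun h0 => (ih2 h0).not_gt hneg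
        refine ⟨by omega, fun _ => ?_⟩
        rw [pow_succ]
        linarith
      -- A new interval: equality at `i + 1` forces equality at `i` and adjacent intervals, so the
      -- shared coefficient has the old sign and the right one must supply the new sign.
      · refine ⟨by omega, fun h0 => ?_⟩
        have h1 := ih2 (by omega)
        rw [show l i + 1 = l (i + 1) by omega] at h1
        have h2 : sineFn Q (μ * ((l (i + 1) + 1) / n - x (i + 1))) *
            (ε * (-1) ^ (i + 1) * c (l (i + 1))) < 0 := by
          refine mul_neg_of_pos_of_neg (hA _ hi) ?_
          rw [pow_succ]
          linarith
        exact pos_of_mul_pos_right (a := sineFn Q (μ * (x (i + 1) - l (i + 1) / n)))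
          (by linarith) (hB _ hi)
  obtain ⟨h1, h2⟩ := main (b - a) le_rfl
  obtain ⟨hln, -, hpos⟩ := hl (b - a) le_rfl
  -- The last sample has `b ≤ l + 1`: either `l + 1 = b` and a zero coefficient would have a strict
  -- sign, or both coefficients of its interval vanish.
  rcases lt_or_ge (l (b - a)) b with h3 | h3
  · have h4 := h2 (by omega)
    rw [hcb _ (by omega) (by omega)] at h4
    simp at h4
  · rw [hcb _ (by omega) h3, hcb (l (b - a) + 1) (by omega) (by omega)] at hpos
    simp at hpos

theorem eq_zero_of_comb_zero (h : Admissible Q n μ) (hn : 0 < n) (c : ℕ → ℝ)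
    (hc : ∀ x ∈ cells n, comb Q μ n p 0 p c x = 0) {l : ℕ} (hl : l < n) :
    c l = 0 ∧ c (l + 1) = 0 := by
  have hn' : (0 : ℝ) < n := by exact_mod_cast hn
  have hS := h.sineFn_step_pos hn
  have hlt : (l : ℝ) / n < (l + 1) / n := by gcongr; linarith
  obtain ⟨x, hx1, hx2⟩ := exists_between hlt
  obtain ⟨y, hy1, hy2⟩ := exists_between hx2
  have e1 := hc x (Ioo_subset_cells hl ⟨hx1, hx2⟩)
  have e2 := hc y (Ioo_subset_cells hl ⟨hx1.trans hy1, hy2⟩)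
  rw [comb_zero_of_mem hn hl ⟨hx1.le, hx2⟩, div_eq_zero_iff, or_iff_left hS.ne'] at e1
  rw [comb_zero_of_mem hn hl ⟨(hx1.trans hy1).le, hy2⟩, div_eq_zero_iff, or_iff_left hS.ne'] at e2
  have hA := h.sineFn_cell_pos hn hx1.le le_rfl hx2
  have hdet := mul_pos hS (h.sineFn_cell_pos hn hx1.le hy2.le hy1)
  have h1 : c (l + 1) = 0 := by
    have := sineFn_cell_mul_sub Q μ n l x y
    refine (mul_eq_zero.1 ?_).resolve_left hdet.ne'
    rw [← this]
    linear_combination sineFn Q (μ * ((l + 1) / n - x)) * e2 -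
      sineFn Q (μ * ((l + 1) / n - y)) * e1
  rw [h1, mul_zero, add_zero] at e1
  exact ⟨(mul_eq_zero.1 e1).resolve_left hA.ne', h1⟩

theorem goodLevel_zero (h : Admissible Q n μ) (hn : 0 < n) : GoodLevel Q μ n p 0 p where
  regular k _ := piecewiseContinuous_gbs_zero Q μ hn p _
  indep c hc k hk := by
    rcases Nat.lt_or_ge k n with hkn | hkn
    · exact (eq_zero_of_comb_zero h hn c hc hkn).1
    · obtain rfl : k = (n - 1) + 1 := by omega
      exact (eq_zero_of_comb_zero h hn c hc (by omega)).2
  variation c a b hab hca hcb halt := not_alternates_comb_zero h hn c a b hca hcb ⟨hab, halt⟩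

/-- The summands in the recursion for B-splines. -/
noncomputable def cdf (Q : GBKind) (μ : ℝ) (n p q j : ℕ) (x : ℝ) : ℝ :=
  if knot n p j < knot n p (j + q + 2) then
    (∫ s in (0 : ℝ)..x, gbs Q μ n p q j s) / (∫ s in (0 : ℝ)..1, gbs Q μ n p q j s)
  else if knot n p j ≤ x then 1 else 0

theorem gbs_succ (Q : GBKind) (μ : ℝ) (n p q i : ℕ) (x : ℝ) :
    gbs Q μ n p (q + 1) i x = cdf Q μ n p q i x - cdf Q μ n p q (i + 1) x := rfl

theorem cdf_of_nondegenerate {q r k : ℕ} (hn : 0 < n) (hp : p = q + (r + 1)) (hk : k < n + q + 1)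
    (x : ℝ) : cdf Q μ n p q (r + 1 + k) x =
      (∫ s in (0 : ℝ)..x, gbs Q μ n p q (r + 1 + k) s) /
        ∫ s in (0 : ℝ)..1, gbs Q μ n p q (r + 1 + k) s := by
  rw [cdf, if_pos]
  rw [knot_lt_knot_iff hn]
  omega

theorem cdf_left {q r : ℕ} (hn : 0 < n) (hp : p = q + (r + 1)) {x : ℝ} (hx : 0 ≤ x) :
    cdf Q μ n p q r x = 1 := by
  rw [cdf, if_neg, if_pos]
  · simp [knot, show r - (p + 1) = 0 by omega, hx]
  · rw [knot_lt_knot_iff hn]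
    omega

theorem cdf_right {q r : ℕ} (hn : 0 < n) (hp : p = q + (r + 1)) {x : ℝ} (hx : x < 1) :
    cdf Q μ n p q (r + (n + q + 1 + 1)) x = 0 := by
  rw [cdf, if_neg, if_neg]
  · rw [knot_eq (l := n) le_rfl (by omega), div_self (by positivity)]
    exact hx.not_ge
  · rw [knot_lt_knot_iff hn]
    omega

theorem sum_mul_sub_succ (c F : ℕ → ℝ) (L : ℕ) :
    ∑ k ∈ Finset.range (L + 1), c k * (F k - F (k + 1)) =
      c 0 * F 0 + ∑ k ∈ Finset.range L, (c (k + 1) - c k) * F (k + 1) - c L * F (L + 1) := by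
  induction L with
  | zero => simp; ring
  | succ L ih => rw [Finset.sum_range_succ, ih, Finset.sum_range_succ _ L]; ring

/-- The coefficients of the derivative of a combination of B-splines. -/
noncomputable def diffCoeff (Q : GBKind) (μ : ℝ) (n p q r : ℕ) (c : ℕ → ℝ) (k : ℕ) : ℝ :=
  (c (k + 1) - c k) / ∫ s in (0 : ℝ)..1, gbs Q μ n p q (r + 1 + k) s

/-- The continuous extension to `[0, 1]` of a combination of B-splines. -/
noncomputable def prim (Q : GBKind) (μ : ℝ) (n p q r : ℕ) (c : ℕ → ℝ) (x : ℝ) : ℝ :=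
  c 0 + ∑ k ∈ Finset.range (n + q + 1), diffCoeff Q μ n p q r c k *
    ∫ s in (0 : ℝ)..x, gbs Q μ n p q (r + 1 + k) s

/-- Summation by parts. The degenerate quotients at the two ends are 1 and 0 on `(0, 1)`; the right
one jumps at `x = 1`, where the identity may fail. -/
theorem comb_succ_eq_prim {q r : ℕ} (hn : 0 < n) (hp : p = q + (r + 1)) (c : ℕ → ℝ) {x : ℝ}
    (hx : x ∈ Ioo (0 : ℝ) 1) : comb Q μ n p (q + 1) r c x = prim Q μ n p q r c x := by
  unfold comb prim
  have := sum_mul_sub_succ c (fun k => cdf Q μ n p q (r + k) x) (n + q + 1)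
  simp only [add_zero, cdf_left hn hp hx.1.le, cdf_right hn hp hx.2, mul_one, mul_zero,
    sub_zero] at this
  simp only [gbs_succ, add_assoc r]
  refine this.trans ?_
  congr 1
  refine Finset.sum_congr rfl fun k hk => ?_
  rw [show r + (k + 1) = r + 1 + k by omega, cdf_of_nondegenerate hn hp (Finset.mem_range.1 hk),
    diffCoeff, add_comm 1 k, show r + (k + 1) = r + 1 + k by omega]
  ring

theorem prim_zero (q r : ℕ) (c : ℕ → ℝ) : prim Q μ n p q r c 0 = c 0 := by
  simp [prim]

theorem comb_single {q r k : ℕ} (hk : k < n + q + 1) (x : ℝ) :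
    comb Q μ n p q r (Pi.single k 1) x = gbs Q μ n p q (r + k) x := by
  unfold comb
  rw [Finset.sum_eq_single k] <;> simp +contextual [hk]

namespace GoodLevel

variable {q r : ℕ}

theorem piecewiseContinuous_comb (G : GoodLevel Q μ n p q r) (c : ℕ → ℝ) :
    PiecewiseContinuous n (comb Q μ n p q r c) :=
  PiecewiseContinuous.sum _ fun k hk =>
    (PiecewiseContinuous.const n (c k)).mul (G.regular k (Finset.mem_range.1 hk))

/-- This justifies the divisions in the recursion: independence makes the spline nonzero somewhere,
and variation with the range `[k, k + 1)` rules out a sign change. -/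
theorem integral_ne_zero (G : GoodLevel Q μ n p q r) {k : ℕ} (hk : k < n + q + 1) :
    ∫ s in (0 : ℝ)..1, gbs Q μ n p q (r + k) s ≠ 0 := by
  have hne : ∃ x ∈ cells n, gbs Q μ n p q (r + k) x ≠ 0 := by
    by_contra! hcon
    have := G.indep (Pi.single k 1) (fun x hx => by rw [comb_single hk]; exact hcon x hx) k hk
    simp at this
  obtain ⟨x, hx, hx0⟩ := hne
  refine integral_ne_zero_of_not_alternates (G.regular k hk) (fun halt => ?_) hx hx0
  refine G.variation (Pi.single k 1) k (k + 1) (by omega) ?_ ?_ ?_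
  · intro m _ hm
    simp [hm.ne]
  · intro m _ hm
    simp [show m ≠ k by omega]
  · rw [Nat.add_sub_cancel_left]
    exact halt.congr fun x _ => (comb_single hk x).symm

theorem prim_one (G : GoodLevel Q μ n p q (r + 1)) (c : ℕ → ℝ) :
    prim Q μ n p q r c 1 = c (n + q + 1) := by
  unfold prim diffCoeff
  rw [Finset.sum_congr rfl fun k hk => div_mul_cancel₀ _ (G.integral_ne_zero
    (Finset.mem_range.1 hk)), Finset.sum_range_sub]
  ring

theorem continuousOn_prim (G : GoodLevel Q μ n p q (r + 1)) (c : ℕ → ℝ) :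
    ContinuousOn (prim Q μ n p q r c) (Icc 0 1) :=
  continuousOn_const.add <| continuousOn_finsetSum _ fun k hk =>
    continuousOn_const.mul (G.regular k (Finset.mem_range.1 hk)).continuousOn_primitive

theorem hasDerivAt_prim (G : GoodLevel Q μ n p q (r + 1)) (c : ℕ → ℝ) {x : ℝ}
    (hx : x ∈ cells n) : HasDerivAt (prim Q μ n p q r c)
      (comb Q μ n p q (r + 1) (diffCoeff Q μ n p q r c) x) x := by
  refine HasDerivAt.const_add _ (HasDerivAt.fun_sum fun k hk => ?_)
  exact ((G.regular k (Finset.mem_range.1 hk)).hasDerivAt_primitive hx).const_mul _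

theorem prim_sub_prim (G : GoodLevel Q μ n p q (r + 1)) (c : ℕ → ℝ) {a b : ℝ}
    (ha : a ∈ Icc (0 : ℝ) 1) (hb : b ∈ Icc (0 : ℝ) 1) :
    prim Q μ n p q r c b - prim Q μ n p q r c a =
      ∫ s in a..b, comb Q μ n p q (r + 1) (diffCoeff Q μ n p q r c) s := by
  unfold prim comb
  rw [add_sub_add_left_eq_sub, ← Finset.sum_sub_distrib, intervalIntegral.integral_finsetSum]
  · refine Finset.sum_congr rfl fun k hk => ?_
    rw [← mul_sub, intervalIntegral.integral_const_mul,
      (G.regular k (Finset.mem_range.1 hk)).integral_sub_integral ha hb]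
  · exact fun k hk => ((G.regular k (Finset.mem_range.1 hk)).intervalIntegrable_of_mem
      ha hb).const_mul _

/-- Differentiation and independence one degree lower make all coefficients equal; their common
value is then that of the combination, hence zero. -/
theorem eq_zero_of_comb_succ (G : GoodLevel Q μ n p q (r + 1)) (hn : 0 < n)
    (hp : p = q + (r + 1)) (c : ℕ → ℝ)
    (hc : ∀ x ∈ cells n, comb Q μ n p (q + 1) r c x = 0) :
    ∀ k < n + (q + 1) + 1, c k = 0 := by
  have hc' : ∀ x ∈ cells n, prim Q μ n p q r c x = 0 := fun x hx => by
    rw [← comb_succ_eq_prim hn hp c (cells_subset n hx)]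
    exact hc x hx
  have hd := G.indep (diffCoeff Q μ n p q r c) fun x hx => by
    refine (G.hasDerivAt_prim c hx).unique ((hasDerivAt_const x (0 : ℝ)).congr_of_eventuallyEq ?_)
    filter_upwards [(isOpen_cells n).mem_nhds hx] with y hy
    exact hc' y hy
  have h0 : c 0 = 0 := by
    have hlt : ((0 : ℕ) : ℝ) / n < ((0 : ℕ) + 1) / n := by
      have hn' : (0 : ℝ) < n := by exact_mod_cast hn
      gcongr
      linarith
    obtain ⟨x, hx⟩ := exists_between hlt
    have := hc' x (Ioo_subset_cells hn hx)
    rwa [prim, Finset.sum_eq_zero, add_zero] at this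
    intro k hk
    rw [hd k (Finset.mem_range.1 hk), zero_mul]
  intro k
  induction k with
  | zero => exact fun _ => h0
  | succ k ih =>
    intro hk
    have h1 := (div_eq_zero_iff.1 (hd k (by omega))).resolve_right
      (G.integral_ne_zero (by omega))
    rw [sub_eq_zero.1 h1]
    exact ih (by omega)

/-- Rolle costs one sign change, and each end where the combination is known to vanish returns one.
The range of possibly nonzero difference coefficients varies in the same way, so the bound passes to
the higher degree. -/
theorem not_alternates_succ (G : GoodLevel Q μ n p q (r + 1)) (hn : 0 < n)
    (hp : p = q + (r + 1)) (c : ℕ → ℝ) (a b : ℕ) (hab : a ≤ b)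
    (hca : ∀ k < n + (q + 1) + 1, k < a → c k = 0)
    (hcb : ∀ k < n + (q + 1) + 1, b ≤ k → c k = 0) :
    ¬ Alternates (comb Q μ n p (q + 1) r c) (b - a) := by
  intro halt
  have halt' : Alternates (prim Q μ n p q r c) (b - a) :=
    halt.congr fun x hx => comb_succ_eq_prim hn hp c hx
  have hder : ∀ {m}, Zigzags (prim Q μ n p q r c) (m + 1) →
      Alternates (comb Q μ n p q (r + 1) (diffCoeff Q μ n p q r c)) m := fun hz =>
    hz.alternates (G.piecewiseContinuous_comb _) fun x hx y hy => G.prim_sub_prim c hx hy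
  have hdiff : ∀ k, c k = 0 → c (k + 1) = 0 → diffCoeff Q μ n p q r c k = 0 := fun k h1 h2 => by
    rw [diffCoeff, h1, h2, sub_zero, zero_div]
  have hdb : ∀ b', min b (n + q + 1) ≤ b' → ∀ k < n + q + 1, b' ≤ k →
      diffCoeff Q μ n p q r c k = 0 := fun b' hb' k hk hbk =>
    hdiff k (hcb k (by omega) (by omega)) (hcb _ (by omega) (by omega))
  have hda : ∀ k < n + q + 1, k < a - 1 → diffCoeff Q μ n p q r c k = 0 := fun k hk hka =>
    hdiff k (hca k (by omega) (by omega)) (hca _ (by omega) (by omega))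
  have h0 : 0 < a → prim Q μ n p q r c 0 = 0 := fun ha => by
    rw [prim_zero, hca 0 (by omega) ha]
  have h1 : b ≤ n + q + 1 → prim Q μ n p q r c 1 = 0 := fun hb => by
    rw [G.prim_one, hcb _ (by omega) hb]
  -- The cases record which end coefficients are known to vanish. For `a = 0` the truncated `a - 1`
  -- is again 0; for `b > n + q + 1` the difference range already ends by `b - 1`.
  rcases Nat.eq_zero_or_pos a with ha | ha <;> rcases Nat.lt_or_ge (n + q + 1) b with hb | hb
  · refine G.variation _ (a - 1) (b - 1) (by omega) hda (hdb _ (by omega)) (hder ?_)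
    rw [show b - 1 - (a - 1) + 1 = b - a by omega]
    exact halt'.zigzags
  · refine G.variation _ (a - 1) b (by omega) hda (hdb _ (by omega)) (hder ?_)
    rw [show b - (a - 1) + 1 = b - a + 1 by omega]
    exact halt'.zigzags_right (h1 hb)
  · by_cases hab' : a = b
    · subst hab'
      obtain ⟨x, ε, hx, -, hs⟩ := halt
      have := hs 0 (by omega)
      rw [comb, Finset.sum_eq_zero] at this
      · simp at this
      · intro k hk
        rw [hca k (Finset.mem_range.1 hk) (by have := Finset.mem_range.1 hk; omega), zero_mul]
    refine G.variation _ (a - 1) (b - 1) (by omega) hda (hdb _ (by omega)) (hder ?_)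
    rw [show b - 1 - (a - 1) + 1 = b - a + 1 by omega]
    exact halt'.zigzags_left (h0 ha)
  · refine G.variation _ (a - 1) b (by omega) hda (hdb _ (by omega)) (hder ?_)
    rw [show b - (a - 1) + 1 = b - a + 2 by omega]
    exact halt'.zigzags_both (h0 ha) (h1 hb)

end GoodLevel

theorem goodLevel_succ {q r : ℕ} (hn : 0 < n) (hp : p = q + (r + 1))
    (G : GoodLevel Q μ n p q (r + 1)) : GoodLevel Q μ n p (q + 1) r where
  regular k hk := (PiecewiseContinuous.of_continuousOn
    (G.continuousOn_prim (Pi.single k 1))).congr fun x hx => by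
      rw [← comb_succ_eq_prim hn hp _ (cells_subset n hx), comb_single hk]
  indep := G.eq_zero_of_comb_succ hn hp
  variation := G.not_alternates_succ hn hp

theorem goodLevel (h : Admissible Q n μ) (hn : 0 < n) :
    ∀ q r : ℕ, p = q + r → GoodLevel Q μ n p q r
  | 0, r, hp => by
    obtain rfl : p = r := by omega
    exact goodLevel_zero h hn
  | q + 1, r, hp => goodLevel_succ hn (by omega) (goodLevel h hn q (r + 1) (by omega))

end Levels

/-! ### Functions with zero boundary values and the Poincaré inequality. -/

/-- `u` is continuous on `[0, 1]`, vanishes at both ends, and has the piecewise continuous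
derivative `u'`. -/
structure HasZeroBoundary (n : ℕ) (u u' : ℝ → ℝ) : Prop where
  continuousOn : ContinuousOn u (Icc 0 1)
  left : u 0 = 0
  right : u 1 = 0
  hasDerivAt : ∀ x ∈ cells n, HasDerivAt u (u' x) x
  deriv : PiecewiseContinuous n u'

theorem integral_eq_sub_of_cells {n : ℕ} {f f' : ℝ → ℝ} (hf : ContinuousOn f (Icc 0 1))
    (hd : ∀ x ∈ cells n, HasDerivAt f (f' x) x) (hf' : PiecewiseContinuous n f') :
    ∫ x in (0 : ℝ)..1, f' x = f 1 - f 0 :=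
  integral_eq_of_hasDerivAt_off_countable_of_le f f' zero_le_one (countable_grid n) hf hd
    hf'.intervalIntegrable

namespace HasZeroBoundary

variable {n : ℕ} {u u' : ℝ → ℝ}

theorem piecewiseContinuous (h : HasZeroBoundary n u u') : PiecewiseContinuous n u :=
  .of_continuousOn h.continuousOn

theorem sum {ι : Type*} [Fintype ι] (a : ι → ℝ) {U U' : ι → ℝ → ℝ}
    (h : ∀ i, HasZeroBoundary n (U i) (U' i)) :
    HasZeroBoundary n (fun x => ∑ i, a i * U i x) (fun x => ∑ i, a i * U' i x) where
  continuousOn := continuousOn_finsetSum _ fun i _ => continuousOn_const.mul (h i).continuousOn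
  left := by simp [(h _).left]
  right := by simp [(h _).right]
  hasDerivAt x hx := HasDerivAt.fun_sum fun i _ => ((h i).hasDerivAt x hx).const_mul _
  deriv := .sum _ fun i _ => (PiecewiseContinuous.const n _).mul (h i).deriv

theorem integral_deriv_mul_self (h : HasZeroBoundary n u u') :
    ∫ x in (0 : ℝ)..1, u' x * u x = 0 := by
  have h1 := integral_eq_sub_of_cells (f := fun x => u x * u x)
    (f' := fun x => 2 * (u' x * u x)) (h.continuousOn.mul h.continuousOn)
    (fun x hx => (((h.hasDerivAt x hx).mul (h.hasDerivAt x hx)).congr_deriv (by ring)))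
    ((PiecewiseContinuous.const n 2).mul (h.deriv.mul h.piecewiseContinuous))
  rw [intervalIntegral.integral_const_mul] at h1
  simp only [h.left, h.right] at h1
  linarith

/-- Jacobi's trick: `w` is the logarithmic derivative of `cos (θ (x - 1/2))`, so `w' = -θ² - w²` and
`u'² = θ² u² + (w u²)' + (u' - w u)²`. The middle term integrates to zero. Strict `θ < π` keeps the
cosine positive on all of `[0, 1]`. -/
theorem sq_mul_integral_sq_le (h : HasZeroBoundary n u u') {θ : ℝ} (h0 : 0 < θ)
    (hπ : θ < Real.pi) :
    θ ^ 2 * ∫ x in (0 : ℝ)..1, u x * u x ≤ ∫ x in (0 : ℝ)..1, u' x * u' x := by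
  have hcos : ∀ x ∈ Icc (0 : ℝ) 1, Real.cos (θ * (x - 1 / 2)) ≠ 0 := fun x hx =>
    (Real.cos_pos_of_mem_Ioo ⟨by nlinarith [hx.1], by nlinarith [hx.2]⟩).ne'
  set w : ℝ → ℝ := fun x => -θ * Real.tan (θ * (x - 1 / 2)) with hw
  have hwd : ∀ x ∈ Icc (0 : ℝ) 1, HasDerivAt w (-θ ^ 2 - w x * w x) x := fun x hx => by
    have hlin : HasDerivAt (fun x : ℝ => θ * (x - 1 / 2)) θ x := by
      simpa using ((hasDerivAt_id x).sub_const (1 / 2 : ℝ)).const_mul θ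
    have := ((Real.hasDerivAt_tan (hcos x hx)).comp x hlin).const_mul (-θ)
    refine this.congr_deriv ?_
    have hc := hcos x hx
    simp only [hw, Real.tan_eq_sin_div_cos]
    generalize θ * (x - 1 / 2) = φ at hc
    field_simp
    linear_combination Real.sin_sq_add_cos_sq φ
  have hwc : ContinuousOn w (Icc 0 1) := fun x hx => (hwd x hx).continuousAt.continuousWithinAt
  have hwp : PiecewiseContinuous n w := .of_continuousOn hwc
  have hup := h.piecewiseContinuous
  have hf' : PiecewiseContinuous n fun x =>
      (-θ ^ 2 + -1 * (w x * w x)) * (u x * u x) + 2 * (w x * (u x * u' x)) :=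
    (((PiecewiseContinuous.const n _).add ((PiecewiseContinuous.const n _).mul
      (hwp.mul hwp))).mul (hup.mul hup)).add
      ((PiecewiseContinuous.const n _).mul (hwp.mul (hup.mul h.deriv)))
  have h1 := integral_eq_sub_of_cells (f := fun x => w x * (u x * u x))
    (hwc.mul (h.continuousOn.mul h.continuousOn)) (fun x hx => by
      have hx' := Ioo_subset_Icc_self (cells_subset n hx)
      exact ((hwd x hx').mul ((h.hasDerivAt x hx).mul (h.hasDerivAt x hx))).congr_deriv
        (by simp only [Pi.mul_apply]; ring)) hf'
  simp only [h.left, h.right, mul_zero, sub_zero] at h1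
  have hsq : PiecewiseContinuous n fun x => (u' x + -1 * (w x * u x)) * (u' x + -1 * (w x * u x)) :=
    have := h.deriv.add ((PiecewiseContinuous.const n (-1)).mul (hwp.mul hup))
    this.mul this
  have hsum : ∫ x in (0 : ℝ)..1, u' x * u' x = ∫ x in (0 : ℝ)..1, (θ ^ 2 * (u x * u x) +
      ((-θ ^ 2 + -1 * (w x * w x)) * (u x * u x) + 2 * (w x * (u x * u' x)))) +
      (u' x + -1 * (w x * u x)) * (u' x + -1 * (w x * u x)) :=
    intervalIntegral.integral_congr fun x _ => by ring
  have hu2 := ((PiecewiseContinuous.const n (θ ^ 2)).mul (hup.mul hup))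
  rw [hsum, intervalIntegral.integral_add (hu2.add hf').intervalIntegrable hsq.intervalIntegrable,
    intervalIntegral.integral_add hu2.intervalIntegrable hf'.intervalIntegrable, h1,
    intervalIntegral.integral_const_mul, add_zero]
  exact le_add_of_nonneg_right (intervalIntegral.integral_nonneg zero_le_one fun x _ =>
    mul_self_nonneg _)

/-- The Poincaré inequality on `[0, 1]` with the optimal constant. -/
theorem pi_sq_mul_integral_sq_le (h : HasZeroBoundary n u u') :
    Real.pi ^ 2 * ∫ x in (0 : ℝ)..1, u x * u x ≤ ∫ x in (0 : ℝ)..1, u' x * u' x := by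
  have hc : Continuous fun θ : ℝ => θ ^ 2 * ∫ x in (0 : ℝ)..1, u x * u x := by fun_prop
  refine le_of_tendsto (hc.continuousWithinAt (s := Iio Real.pi) (x := Real.pi)) ?_
  filter_upwards [Ioo_mem_nhdsLT Real.pi_pos] with θ hθ
  exact h.sq_mul_integral_sq_le hθ.1 hθ.2

end HasZeroBoundary

/-! ### The quadratic form of the Galerkin matrix. -/

/-- The boundary values of `prim` are its first and last coefficients. The unit coefficient of a
basis function sits strictly between them, at position `i + 1`. -/
theorem exists_hasZeroBoundary {Q : GBKind} {μ : ℝ} {n p : ℕ} (hp : 2 ≤ p) (hn : 2 ≤ n)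
    (h : Admissible Q n μ) (i : Fin (n + p - 2)) : ∃ u u' : ℝ → ℝ, HasZeroBoundary n u u' ∧
      (∀ x ∈ cells n, basisFn Q μ n p i x = u x) ∧
      ∀ x ∈ cells n, deriv (basisFn Q μ n p i) x = u' x := by
  obtain ⟨q, rfl⟩ : ∃ q, p = q + 2 := ⟨p - 2, by omega⟩
  have hn0 : 0 < n := by omega
  have hi := i.2
  have G := goodLevel h hn0 (p := q + 2) q 2 rfl
  set c : ℕ → ℝ := Pi.single (i.val + 1) 1 with hc
  have heq : ∀ x ∈ cells n, basisFn Q μ n (q + 2) i x = prim Q μ n (q + 2) q 1 c x :=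
    fun x hx => by
      rw [← comb_succ_eq_prim hn0 rfl c (cells_subset n hx), hc, comb_single (by omega),
        show 1 + (i.val + 1) = i.val + 2 by omega]
      rfl
  refine ⟨prim Q μ n (q + 2) q 1 c, _, ⟨G.continuousOn_prim c, ?_, ?_,
    fun x hx => G.hasDerivAt_prim c hx, G.piecewiseContinuous_comb _⟩, heq, fun x hx => ?_⟩
  · rw [prim_zero, hc]
    simp
  · rw [G.prim_one, hc, Pi.single_eq_of_ne (by omega)]
  · refine HasDerivAt.deriv ((G.hasDerivAt_prim c hx).congr_of_eventuallyEq ?_)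
    filter_upwards [(isOpen_cells n).mem_nhds hx] with y hy
    exact heq y hy

theorem sum_mul_integral {ι : Type*} [Fintype ι] {n : ℕ} (a : ι → ℝ) {F G : ι → ℝ → ℝ}
    (hF : ∀ i, PiecewiseContinuous n (F i)) (hG : ∀ i, PiecewiseContinuous n (G i)) :
    ∑ i, ∑ j, a i * a j * ∫ x in (0 : ℝ)..1, F j x * G i x =
      ∫ x in (0 : ℝ)..1, (∑ i, a i * F i x) * ∑ i, a i * G i x := by
  have hI : ∀ i j, PiecewiseContinuous n fun x => a i * a j * (F j x * G i x) := fun i j =>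
    (PiecewiseContinuous.const n _).mul ((hF j).mul (hG i))
  simp only [← intervalIntegral.integral_const_mul]
  rw [intervalIntegral.integral_congr (g := fun x => ∑ i, ∑ j, a i * a j * (F j x * G i x)),
    intervalIntegral.integral_finsetSum fun i _ =>
      (PiecewiseContinuous.sum _ fun j _ => hI i j).intervalIntegrable]
  · refine Finset.sum_congr rfl fun i _ => ?_
    rw [intervalIntegral.integral_finsetSum fun j _ => (hI i j).intervalIntegrable]
  · intro x _
    simp only
    rw [mul_comm, Finset.sum_mul_sum]
    exact Finset.sum_congr rfl fun i _ => Finset.sum_congr rfl fun j _ => by ring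

/-- The Galerkin matrix over the reals. -/
noncomputable def galerkin (Q : GBKind) (μ : ℝ) (n p : ℕ) (β γ : ℝ) :
    Matrix (Fin (n + p - 2)) (Fin (n + p - 2)) ℝ :=
  (n : ℝ) • matK Q μ n p + β • matH Q μ n p + (γ / n) • matM Q μ n p

theorem galerkin_quadratic_ge {Q : GBKind} {ν : GBRegime} {n p : ℕ} {α β γ : ℝ} (hp : 2 ≤ p)
    (hn : 2 ≤ n) (h : Admissible Q n (phase ν n α)) (hγ : 0 ≤ γ) (a : Fin (n + p - 2) → ℝ) :
    stabilityConst Q ν p α * (Real.pi ^ 2 + γ) / n * ∑ i, a i ^ 2 ≤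
      ∑ i, ∑ j, a i * a j * galerkin Q (phase ν n α) n p β γ i j := by
  have hn' : (0 : ℝ) < n := by exact_mod_cast (by omega : 0 < n)
  have hst := (isGreatest_stabilityConst Q ν p n α hn (by omega) h).1.2 n hn h (WithLp.toLp 2 a)
  choose u u' hu hbu hbu' using fun i => exists_hasZeroBoundary hp hn h i
  have hs := HasZeroBoundary.sum a hu
  have hup := fun i => (hu i).piecewiseContinuous
  have hent : ∀ i j, galerkin Q (phase ν n α) n p β γ i j =
      (∫ x in (0 : ℝ)..1, u' j x * u' i x) + β * (∫ x in (0 : ℝ)..1, u' j x * u i x) +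
        γ * ∫ x in (0 : ℝ)..1, u j x * u i x := fun i j => by
    simp only [galerkin, matK, matH, matM, Matrix.add_apply, Matrix.smul_apply, Matrix.of_apply,
      smul_eq_mul]
    -- The splines and their derivatives are replaced by the regular representatives off the
    -- finitely many knots; the normalizing powers of `n` then cancel.
    rw [integral_congr_cells fun x hx => by rw [hbu' i x hx, hbu' j x hx],
      integral_congr_cells (f := fun x => deriv _ x * basisFn Q (phase ν n α) n p i x)
        fun x hx => by rw [hbu i x hx, hbu' j x hx],
      integral_congr_cells (f := fun x => basisFn Q (phase ν n α) n p j x * _)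
        fun x hx => by rw [hbu i x hx, hbu j x hx]]
    field_simp
  have hsum : ∑ i, ∑ j, a i * a j * galerkin Q (phase ν n α) n p β γ i j =
      (∑ i, ∑ j, a i * a j * ∫ x in (0 : ℝ)..1, u' j x * u' i x) +
      β * (∑ i, ∑ j, a i * a j * ∫ x in (0 : ℝ)..1, u' j x * u i x) +
      γ * ∑ i, ∑ j, a i * a j * ∫ x in (0 : ℝ)..1, u j x * u i x := by
    simp only [hent, Finset.mul_sum, ← Finset.sum_add_distrib]
    exact Finset.sum_congr rfl fun i _ => Finset.sum_congr rfl fun j _ => by ring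
  rw [hsum, sum_mul_integral a (fun i => (hu i).deriv) (fun i => (hu i).deriv),
    sum_mul_integral a (fun i => (hu i).deriv) hup, sum_mul_integral a hup hup,
    hs.integral_deriv_mul_self, mul_zero, add_zero]
  rw [integral_congr_cells (g := fun x => (∑ i, a i * u i x) * ∑ i, a i * u i x) (fun x hx => by
    rw [Finset.sum_congr rfl fun i _ => by rw [hbu i x hx], sq]), EuclideanSpace.norm_sq_eq] at hst
  simp only [Real.norm_eq_abs, sq_abs] at hst
  have hP := hs.pi_sq_mul_integral_sq_le
  calc stabilityConst Q ν p α * (Real.pi ^ 2 + γ) / n * ∑ i, a i ^ 2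
      = (Real.pi ^ 2 + γ) * (stabilityConst Q ν p α * (∑ i, a i ^ 2) / n) := by ring
    _ ≤ (Real.pi ^ 2 + γ) * ∫ x in (0 : ℝ)..1, (∑ i, a i * u i x) * ∑ i, a i * u i x :=
      mul_le_mul_of_nonneg_left hst (by positivity)
    _ ≤ _ := by
      rw [add_mul]
      exact add_le_add_left hP _

/-! ### From quadratic forms to eigenvalues. -/

-- For a real matrix, symmetric or not, the cross terms between `Re v` and `Im v` are purely
-- imaginary, so bounds on real vectors suffice.
open Matrix in
theorem re_star_dotProduct_map_mulVec {m : ℕ} (B : Matrix (Fin m) (Fin m) ℝ) (v : Fin m → ℂ) :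
    (star v ⬝ᵥ (B.map (fun r : ℝ => (r : ℂ))) *ᵥ v).re =
      (∑ i, ∑ j, (v i).re * (v j).re * B i j) + ∑ i, ∑ j, (v i).im * (v j).im * B i j := by
  simp only [dotProduct, mulVec, Matrix.map_apply, Finset.mul_sum, Complex.re_sum,
    ← Finset.sum_add_distrib]
  refine Finset.sum_congr rfl fun i _ => Finset.sum_congr rfl fun j _ => ?_
  simp [Complex.mul_re, Complex.mul_im]
  ring

open Matrix in
theorem re_star_dotProduct_self {m : ℕ} (v : Fin m → ℂ) :
    (star v ⬝ᵥ v).re = (∑ i, (v i).re ^ 2) + ∑ i, (v i).im ^ 2 := by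
  simp only [dotProduct, Complex.re_sum, ← Finset.sum_add_distrib]
  refine Finset.sum_congr rfl fun i _ => ?_
  simp [Complex.mul_re]
  ring

open Matrix in
theorem re_star_dotProduct_realPart_mulVec {m : ℕ} (A : Matrix (Fin m) (Fin m) ℂ)
    (v : Fin m → ℂ) : (star v ⬝ᵥ (realPart A : Matrix (Fin m) (Fin m) ℂ) *ᵥ v).re =
      (star v ⬝ᵥ A *ᵥ v).re := by
  have h : star v ⬝ᵥ Aᴴ *ᵥ v = star (star v ⬝ᵥ A *ᵥ v) := by
    rw [star_dotProduct, star_mulVec, conjTranspose_conjTranspose, ← dotProduct_mulVec]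
  rw [realPart_apply_coe, smul_mulVec, add_mulVec, dotProduct_smul, dotProduct_add,
    star_eq_conjTranspose, h]
  simp
  ring

open Matrix ComplexOrder in
theorem star_dotProduct_self_pos {m : ℕ} {v : Fin m → ℂ} (hv : v ≠ 0) :
    0 < (star v ⬝ᵥ v).re ∧ star v ⬝ᵥ v = ((star v ⬝ᵥ v).re : ℂ) := by
  have h := Complex.pos_iff.1 (dotProduct_star_self_pos_iff.2 hv)
  exact ⟨h.1, Complex.ext rfl h.2.symm⟩

-- Subtracting `lambdaMin X` times the identity shifts the spectrum into the nonnegative reals, so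
-- the difference is positive semidefinite.
open Matrix ComplexOrder in
theorem lambdaMin_mul_le {m : ℕ} (X : selfAdjoint (Matrix (Fin m) (Fin m) ℂ)) (v : Fin m → ℂ) :
    lambdaMin X * (star v ⬝ᵥ v).re ≤ (star v ⬝ᵥ (X : Matrix (Fin m) (Fin m) ℂ) *ᵥ v).re := by
  have hX := Matrix.isHermitian_iff_isSelfAdjoint.mpr X.2
  set Y : Matrix (Fin m) (Fin m) ℂ := X.1 - algebraMap ℝ _ (lambdaMin X) with hY
  have hYh : Y.IsHermitian := hX.sub
    (Matrix.isHermitian_iff_isSelfAdjoint.mpr (IsSelfAdjoint.algebraMap _ (.all _)))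
  have hpos : Y.PosSemidef := hYh.posSemidef_iff_eigenvalues_nonneg.2 fun i => by
    have hmem := hYh.eigenvalues_mem_spectrum_real i
    generalize hYh.eigenvalues i = t at hmem ⊢
    rw [hY, ← spectrum.sub_singleton_eq, hX.spectrum_real_eq_range_eigenvalues] at hmem
    obtain ⟨_, ⟨j, rfl⟩, _, rfl, heq⟩ := hmem
    have : lambdaMin X ≤ hX.eigenvalues j := ciInf_le (Set.finite_range _).bddBelow j
    simp only at heq
    simp only [Pi.zero_apply]
    linarith
  have := hpos.re_dotProduct_nonneg v
  rw [hY, sub_mulVec, dotProduct_sub, Algebra.algebraMap_eq_smul_one, smul_mulVec, one_mulVec,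
    dotProduct_smul] at this
  simp at this
  linarith

open Matrix in
theorem le_lambdaMin {m : ℕ} (hm : 0 < m) (X : selfAdjoint (Matrix (Fin m) (Fin m) ℂ)) (b : ℝ)
    (h : ∀ v : Fin m → ℂ, b * (star v ⬝ᵥ v).re ≤
      (star v ⬝ᵥ (X : Matrix (Fin m) (Fin m) ℂ) *ᵥ v).re) : b ≤ lambdaMin X := by
  have : Nonempty (Fin m) := ⟨⟨0, hm⟩⟩
  refine le_ciInf fun i => ?_
  have hX := Matrix.isHermitian_iff_isSelfAdjoint.mpr X.2
  have h1 := h (hX.eigenvectorBasis i)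
  have h2 := hX.eigenvectorBasis.orthonormal.1 i
  rw [hX.mulVec_eigenvectorBasis, dotProduct_smul] at h1
  have h3 : (star (hX.eigenvectorBasis i : Fin m → ℂ) ⬝ᵥ (hX.eigenvectorBasis i : Fin m → ℂ)).re
      = 1 := by
    rw [re_star_dotProduct_self, ← Finset.sum_add_distrib]
    have := EuclideanSpace.norm_sq_eq (hX.eigenvectorBasis i)
    rw [h2, one_pow] at this
    rw [this]
    refine Finset.sum_congr rfl fun j _ => ?_
    rw [← Complex.normSq_eq_norm_sq, Complex.normSq_apply]
    ring
  rw [Complex.real_smul, Complex.re_ofReal_mul, h3] at h1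
  linarith

end GBSpline

open Matrix in
theorem mainTheorem4 (Q : GBKind) (ν : GBRegime) (p n : ℕ) (hp : 2 ≤ p) (hn : 2 ≤ n)
    (α β γ : ℝ) (hα : Admissible Q n (phase ν n α)) (hγ : 0 ≤ γ)
    (lam : ℂ)
    (hlam : Module.End.HasEigenvalue
      (Matrix.toLin' (matA Q (phase ν n α) n p β γ)) lam)
    (hmin : ∀ lam' : ℂ, Module.End.HasEigenvalue
      (Matrix.toLin' (matA Q (phase ν n α) n p β γ)) lam' → ‖lam‖ ≤ ‖lam'‖) :
    0 ≤ stabilityConst Q ν p α ∧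
    ‖lam‖ ≥ lambdaMin (realPart (matA Q (phase ν n α) n p β γ)) ∧
    lambdaMin (realPart (matA Q (phase ν n α) n p β γ)) ≥
      stabilityConst Q ν p α * (Real.pi ^ 2 + γ) / n := by
  refine ⟨Real.sSup_nonneg fun C hC => hC.1, ?_, ?_⟩
  · obtain ⟨v, hv⟩ := hlam.exists_hasEigenvector
    have hA : matA Q (phase ν n α) n p β γ *ᵥ v = lam • v := by
      rw [← Matrix.toLin'_apply]
      exact hv.apply_eq_smul
    have h1 := lambdaMin_mul_le (realPart (matA Q (phase ν n α) n p β γ)) v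
    obtain ⟨hpos, hreal⟩ := star_dotProduct_self_pos hv.2
    -- At an eigenvector the form of the Hermitian part equals `Re lam` times `‖v‖²`, so its
    -- smallest eigenvalue is at most `Re lam ≤ ‖lam‖`.
    rw [re_star_dotProduct_realPart_mulVec, hA, dotProduct_smul, smul_eq_mul, hreal,
      Complex.re_mul_ofReal, Complex.ofReal_re] at h1
    exact (le_of_mul_le_mul_right h1 hpos).trans (Complex.re_le_norm lam)
  · refine le_lambdaMin (by omega) _ _ fun v => ?_
    rw [re_star_dotProduct_realPart_mulVec, re_star_dotProduct_self]
    refine le_trans ?_ (re_star_dotProduct_map_mulVec (galerkin Q (phase ν n α) n p β γ) v).ge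
    rw [mul_add]
    exact add_le_add (galerkin_quadratic_ge hp hn hα hγ _) (galerkin_quadratic_ge hp hn hα hγ _)
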